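/- Let $D_H$ be a finite weighted oriented graph, that is, an orientation of a finite simple graph $H$ together with a weight $w(v)\in\{1,2,\dots\}$ for every vertex $v$. For a field $K$, the edge ideal $I(D_H)$ is the ideal generated by the monomials $u\,v^{w(v)}$, for the edges $(u,v)$ of $D_H$ (directed from $u$ to $v$), in the polynomial ring over $K$ whose variables are the vertices; $D_H$ is called Cohen–Macaulay (over $K$) if the quotient of this polynomial ring by $I(D_H)$ is a Cohen–Macaulay ring. Suppose that $z$ and $y$ are adjacent vertices of $H$ with $\deg(z)\ge 2$ and $\deg(y)=1$ (the edge between $z$ and $y$ may have either direction), let $x_1,\dots,x_k$ be all the neighbours of $z$ other than $y$, and suppose that $(x_i,z)$ is an edge of $D_H$, directed from $x_i$ to $z$, for $i=1,\dots,k$. Let $D_G=D_H\setminus\{z,y\}$ and $D_F=D_G\setminus\{x_1,\dots,x_k\}$ be the weighted oriented graphs obtained by deleting these vertices, with the induced edges and weights. If $D_H$ is Cohen–Macaulay over $K$, then $D_G$ and $D_F$ are Cohen–Macaulay over $K$. -/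

import Mathlib

universe u v

/-- The depth of a local ring: the supremum of the lengths of the regular sequences contained in
its maximal ideal. -/
noncomputable def localRingDepth (R : Type u) [CommRing R] [IsLocalRing R] : ℕ∞ :=
  ⨆ (rs : List R) (_ : (∀ r ∈ rs, r ∈ IsLocalRing.maximalIdeal R) ∧
    RingTheory.Sequence.IsRegular R rs), (rs.length : ℕ∞)

/-- A Cohen–Macaulay local ring: a Noetherian local ring whose depth equals its Krull dimension. -/
structure IsCohenMacaulayLocalRing (R : Type u) [CommRing R] [IsLocalRing R] : Prop where
  isNoetherianRing : IsNoetherianRing R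
  depth_eq_dim : (localRingDepth R : WithBot ℕ∞) = ringKrullDim R

/-- A Cohen–Macaulay ring: a Noetherian ring all of whose localizations at prime ideals are
Cohen–Macaulay local rings. -/
structure IsCohenMacaulayRing (R : Type u) [CommRing R] : Prop where
  isNoetherianRing : IsNoetherianRing R
  localization : ∀ (P : Ideal R) [P.IsPrime], IsCohenMacaulayLocalRing (Localization.AtPrime P)

/-- A weighted oriented graph on the vertex set `V`: an orientation of a simple graph, together
with a positive integer weight on every vertex. `D.Adj u v` means that `(u, v)` is an edge, directed
from `u` to `v`. Asymmetry excludes loops and pairs of opposite edges, so that every edge of the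
underlying simple graph carries exactly one direction. -/
structure WeightedOrientedGraph (V : Type u) extends Digraph V where
  asymm : ∀ a b, Adj a b → ¬ Adj b a
  weight : V → ℕ
  weight_pos : ∀ a, 0 < weight a

namespace WeightedOrientedGraph

/-- The underlying simple graph: `a` and `b` are adjacent iff `(a, b)` or `(b, a)` is an edge. -/
def underlying {V : Type u} (D : WeightedOrientedGraph V) : SimpleGraph V :=
  D.toDigraph.toSimpleGraphInclusive

/-- The weighted oriented graph `D ∖ S` obtained by deleting the vertices in `S`: the induced
weighted oriented subgraph on the vertices not in `S`, with the same directions and weights. -/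
def deleteVertices {V : Type u} (D : WeightedOrientedGraph V) (S : Set V) :
    WeightedOrientedGraph {a : V // a ∉ S} where
  Adj a b := D.Adj a b
  asymm a b h := D.asymm a b h
  weight a := D.weight a
  weight_pos a := D.weight_pos a

/-- The edge ideal of `D` over `K`: the ideal of the polynomial ring in the vertices generated by
the monomials `x_a * x_b ^ w(b)` for the edges `(a, b)` of `D`. -/
noncomputable def edgeIdeal {V : Type u} (D : WeightedOrientedGraph V) (K : Type v) [Field K] :
    Ideal (MvPolynomial V K) :=
  Ideal.span {p | ∃ a b : V, D.Adj a b ∧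
    p = MvPolynomial.X a * MvPolynomial.X b ^ D.weight b}

/-- `D` is Cohen–Macaulay over `K` if the quotient of the polynomial ring by the edge ideal is a
Cohen–Macaulay ring. -/
def IsCohenMacaulay {V : Type u} (D : WeightedOrientedGraph V) (K : Type v) [Field K] : Prop :=
  IsCohenMacaulayRing (MvPolynomial V K ⧸ D.edgeIdeal K)

end WeightedOrientedGraph

/-! Let `B`, `A`, `A_F` be the edge rings of `D_H`, `D_G`, `D_F`, let `m = w(z)` and `f = y - z ^
m`. The claim is that both `A` and `A_F` are direct summands of the `A`-module `B ⧸ (f)`, and that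
this module inherits enough regular sequences from `B`.

The summands: `A` is generated by the class of `1` and split off by `y, z ↦ 0`. Since each `x_i z ^
m` vanishes, the class of `z ^ m` is killed by the kernel of `A → A_F`. It is split off by sending
`x_i ↦ 0`, `z ↦ X`, `y ↦ X ^ m` in `A_F[X] ⧸ (X ^ (m + 1))` and reading the coefficient of `X ^ m`.

The regular sequences (`IsCohenMacaulayRing.of_directSummand`): let `A'` be either summand, `Q'` a
prime of `A'`, `Q` its preimage in `A`, and `P` the preimage of `Q` under `B → A`, `y, z ↦ 0`.
Choose `s ⊆ Q` with `ht Q` elements and `Q` minimal over `s`. As `z` is nilpotent modulo `f`, the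
elements `f, s` generate an ideal of definition of `B_P`; as `y` becomes a free variable once `z =
0`, `dim B_P ≥ ht Q + 1`. Because `B_P` is Cohen–Macaulay, `f, s` is regular. Hence `s` is regular
on `B_P ⧸ (f)`, which is the localization of `B ⧸ (f)` at `Q`, and so on its summand `A'_{Q'}`,
whose dimension is at most `ht Q`. -/

/-- Prime avoidance for a coset: if no prime of a finite set contains `y` and `J`, then some
element of `y + J` lies in none of them. -/
theorem Ideal.exists_mem_forall_add_notMem {R : Type*} [CommRing R] (T : Finset (Ideal R))
    (y : R) (J : Ideal R) (hT : ∀ p ∈ T, p.IsPrime) (h : ∀ p ∈ T, y ∈ p → ¬ J ≤ p) :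
    ∃ c ∈ J, ∀ p ∈ T, y + c ∉ p := by
  classical
  induction T using Finset.strongInduction with
  | H T ih =>
    rcases T.eq_empty_or_nonempty with rfl | hne
    · exact ⟨0, J.zero_mem, by simp⟩
    -- With `p` minimal, no other prime of `T` lies in `p`, so `p` can be avoided by a correction
    -- inside `J` and all the others.
    obtain ⟨p, hpT, hmin⟩ := T.exists_minimal hne
    have hss : T.erase p ⊂ T := Finset.erase_ssubset hpT
    obtain ⟨c, hcJ, hc⟩ := ih _ hss (fun q hq => hT q (hss.1 hq)) (fun q hq => h q (hss.1 hq))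
    have := hT p hpT
    by_cases hyc : y + c ∈ p
    · have hJp : ¬ J ≤ p := fun hJ => h p hpT (by simpa using p.sub_mem hyc (hJ hcJ)) hJ
      have hnle : ¬ J ⊓ (T.erase p).inf id ≤ p := by
        intro hle
        rcases (Ideal.IsPrime.inf_le this).1 hle with h1 | h1
        · exact hJp h1
        · obtain ⟨q, hq, hqp⟩ := (Ideal.IsPrime.inf_le' this).1 h1
          exact Finset.ne_of_mem_erase hq
            (le_antisymm hqp (hmin (Finset.mem_of_mem_erase hq) hqp))
      obtain ⟨e, he, hep⟩ := SetLike.not_le_iff_exists.1 hnle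
      refine ⟨c + e, J.add_mem hcJ he.1, fun q hq hmem => ?_⟩
      rw [← add_assoc] at hmem
      rcases eq_or_ne q p with rfl | hqp
      · exact hep (by simpa using q.sub_mem hmem hyc)
      · have hq' : q ∈ T.erase p := Finset.mem_erase.2 ⟨hqp, hq⟩
        have heq : e ∈ q := (Finset.inf_le (f := id) hq') he.2
        exact hc q hq' (by simpa using q.sub_mem hmem heq)
    · refine ⟨c, hcJ, fun q hq => ?_⟩
      rcases eq_or_ne q p with rfl | hqp
      · exact hyc
      · exact hc q (Finset.mem_erase.2 ⟨hqp, hq⟩)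

/-! ### Depth via `Ext`, and systems of parameters in Cohen–Macaulay local rings -/

section
open CategoryTheory Abelian RingTheory.Sequence IsLocalRing Pointwise

/-- In the long exact sequence of `0 → M → M → M/xM → 0`, the term `Ext^i(N, M/xM)` sits between
`Ext^i(N, M)` and `Ext^(i+1)(N, M)`: passing to the quotient costs one degree of vanishing. -/
theorem subsingleton_ext_quotSMulTop {R : Type u} [CommRing R] (N M : ModuleCat.{u} R) {x : R}
    (hx : IsSMulRegular M x) {n : ℕ} (h : ∀ i < n + 1, Subsingleton (Ext N M i)) :
    ∀ i < n, Subsingleton (Ext N (ModuleCat.of R (QuotSMulTop x M)) i) := by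
  intro i hi
  have zero1 := AddCommGrpCat.isZero_of_iff_subsingleton.mpr (h i (by omega))
  have zero2 := AddCommGrpCat.isZero_of_iff_subsingleton.mpr (h (i + 1) (by omega))
  exact AddCommGrpCat.subsingleton_of_isZero <| ShortComplex.Exact.isZero_of_both_zeros
    ((Ext.covariant_sequence_exact₃' N hx.smulShortComplex_shortExact) i (i + 1) rfl)
    (zero1.eq_zero_of_src _) (zero2.eq_zero_of_tgt _)

/-- Regularity of the last member of a sequence only depends on its class modulo the others. -/
theorem RingTheory.Sequence.IsWeaklyRegular.append_singleton_of_sub_mem {R M : Type*} [CommRing R]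
    [AddCommGroup M] [Module R M] {ys : List R} {u y : R} (hsub : u - y ∈ Ideal.ofList ys)
    (h : IsWeaklyRegular M (ys ++ [u])) : IsWeaklyRegular M (ys ++ [y]) := by
  rw [isWeaklyRegular_append_iff, isWeaklyRegular_singleton_iff] at h ⊢
  refine ⟨h.1, ?_⟩
  have key : ∀ q : M ⧸ (Ideal.ofList ys • ⊤ : Submodule R M), u • q = y • q := by
    intro q
    obtain ⟨q, rfl⟩ := Submodule.Quotient.mk_surjective _ q
    rw [← Submodule.Quotient.mk_smul, ← Submodule.Quotient.mk_smul, Submodule.Quotient.eq,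
      ← sub_smul]
    exact Submodule.smul_mem_smul hsub trivial
  intro a b hab
  apply h.2
  simpa [key] using hab

/-- Over a Noetherian local ring, a sequence in the maximal ideal that generates an ideal of
definition of `M`, of length at most the depth of `M`, is `M`-regular. -/
theorem isWeaklyRegular_of_subsingleton_ext {R : Type u} [CommRing R] [IsNoetherianRing R]
    [IsLocalRing R] (ys : List R) (M : ModuleCat.{u} R) [Module.Finite R M]
    (hext : ∀ i < ys.length, Subsingleton (Ext (ModuleCat.of R (R ⧸ maximalIdeal R)) M i))
    (hmem : ∀ y ∈ ys, y ∈ maximalIdeal R)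
    (hrad : ∀ p : Ideal R, p.IsPrime → Module.annihilator R M ≤ p → (∀ y ∈ ys, y ∈ p) →
      maximalIdeal R ≤ p) : IsWeaklyRegular M ys := by
  induction ys generalizing M with
  | nil => exact .nil R M
  | cons y ys ih =>
    have : Subsingleton (ModuleCat.of R (R ⧸ maximalIdeal R) ⟶ M) :=
      Ext.addEquiv₀.subsingleton_congr.mp (hext 0 (by simp))
    have : Subsingleton ((R ⧸ maximalIdeal R) →ₗ[R] M) :=
      (ModuleCat.homAddEquiv (M := ModuleCat.of R (R ⧸ maximalIdeal R)) (N := M)).symm.subsingleton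
    obtain ⟨x, hx, hxreg⟩ := IsSMulRegular.subsingleton_linearMap_iff.mp this
    rw [Ideal.annihilator_quotient] at hx
    have hreg (r : R) : IsSMulRegular M r ↔ ∀ p ∈ associatedPrimes R M, r ∉ p := by
      have := Set.ext_iff.1 (biUnion_associatedPrimes_eq_compl_regular R M) r
      simp only [Set.mem_iUnion, SetLike.mem_coe, Set.mem_compl_iff, Set.mem_ofPred_eq,
        exists_prop] at this
      rw [← not_iff_not, ← this]
      push Not
      rfl
    have hfin := associatedPrimes.finite R M
    -- `y` itself is not yet known to be regular, so it is moved within `y + (ys)` off all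
    -- associated primes. An associated prime containing `y` and `ys` would contain the maximal
    -- ideal, hence the regular element `x`.
    obtain ⟨c, hc, hcp⟩ := Ideal.exists_mem_forall_add_notMem hfin.toFinset y (Ideal.ofList ys)
      (fun p hp => (hfin.mem_toFinset.1 hp).isPrime) (fun p hp hyp hle => by
        have hp := hfin.mem_toFinset.1 hp
        refine (hreg x).1 hxreg p hp
          (hrad p hp.isPrime (Submodule.annihilator_top.ge.trans hp.annihilator_le) ?_ hx)
        intro z hz
        rcases List.mem_cons.1 hz with rfl | hz
        · exact hyp
        · exact hle (Ideal.subset_span hz))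
    have hmem' : ∀ z ∈ ys, z ∈ maximalIdeal R := fun z hz => hmem z (by simp [hz])
    have hcm : c ∈ maximalIdeal R := Ideal.span_le.2 hmem' hc
    have hu : IsSMulRegular M (y + c) :=
      (hreg _).2 fun p hp => hcp p (hfin.mem_toFinset.2 hp)
    have h1 : IsWeaklyRegular (QuotSMulTop (y + c) M) ys := by
      refine ih (ModuleCat.of R (QuotSMulTop (y + c) M)) (subsingleton_ext_quotSMulTop _ M hu hext)
        hmem' fun p hp hann hys => ?_
      have hup : y + c ∈ p := hann (QuotSMulTop.mem_annihilator M (y + c))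
      have hcp' : c ∈ p := Ideal.span_le.2 hys hc
      refine hrad p hp (le_trans (fun r hr => ?_) hann) fun z hz => ?_
      · exact LinearMap.annihilator_le_of_surjective (Submodule.mkQ _)
          (Submodule.mkQ_surjective _) hr
      · rcases List.mem_cons.1 hz with rfl | hz
        · simpa using p.sub_mem hup hcp'
        · exact hys z hz
    have h2 : IsWeaklyRegular M ((y + c) :: ys) := IsWeaklyRegular.cons hu h1
    -- Placed last, `y + c` acts modulo `ys` exactly as `y` does; permutability over a local ring
    -- allows the move there and back.
    have h3 : IsWeaklyRegular M (ys ++ [y + c]) :=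
      isWeaklyRegular_of_perm_of_subset_maximalIdeal h2 (List.perm_append_singleton _ _).symm
        (fun r hr => by
          rcases List.mem_cons.1 hr with rfl | hr
          · exact add_mem (hmem y (by simp)) hcm
          · exact hmem' r hr)
    have h4 : IsWeaklyRegular M (ys ++ [y]) := h3.append_singleton_of_sub_mem (by simpa using hc)
    refine isWeaklyRegular_of_perm_of_subset_maximalIdeal h4 (List.perm_append_singleton _ _)
      (fun r hr => hmem r ?_)
    simpa [or_comm] using hr

/-- In a Cohen–Macaulay local ring a sequence in the maximal ideal of length at most the dimension
that generates an ideal of definition is regular. -/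
theorem IsCohenMacaulayLocalRing.isWeaklyRegular {R : Type u} [CommRing R] [IsLocalRing R]
    (hR : IsCohenMacaulayLocalRing R) (ys : List R)
    (hlen : (ys.length : WithBot ℕ∞) ≤ ringKrullDim R)
    (hmem : ∀ y ∈ ys, y ∈ maximalIdeal R)
    (hrad : ∀ p : Ideal R, p.IsPrime → (∀ y ∈ ys, y ∈ p) → maximalIdeal R ≤ p) :
    IsWeaklyRegular R ys := by
  have := hR.isNoetherianRing
  rw [← hR.depth_eq_dim] at hlen
  have hlen : (ys.length : ℕ∞) ≤ localRingDepth R := by exact_mod_cast hlen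
  obtain ⟨rs, hrs, hreg, hle⟩ : ∃ rs : List R, (∀ r ∈ rs, r ∈ maximalIdeal R) ∧
      IsRegular R rs ∧ ys.length ≤ rs.length := by
    -- If every regular sequence were shorter than `ys`, the supremum would be at most `ys.length -
    -- 1`; the empty `ys` is treated apart because of truncated subtraction.
    by_contra! hcon
    rcases Nat.eq_zero_or_pos ys.length with h0 | hpos
    · exact absurd (hcon [] (by simp) (IsRegular.nil R R)) (by simp [h0])
    · have : localRingDepth R ≤ ((ys.length - 1 : ℕ) : ℕ∞) := by
        refine iSup₂_le fun rs h => ?_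
        have := hcon rs h.1 h.2
        exact_mod_cast (by omega : rs.length ≤ ys.length - 1)
      have := hlen.trans this
      have : ys.length ≤ ys.length - 1 := by exact_mod_cast this
      omega
  have hext := ModuleCat.subsingleton_ext_of_exists_isRegular (maximalIdeal R)
    (ModuleCat.of R (R ⧸ maximalIdeal R))
    (by rw [Module.support_eq_zeroLocus, Ideal.annihilator_quotient]) (ModuleCat.of R R)
    (by
      rw [lt_top_iff_ne_top, smul_eq_mul, Ideal.mul_top]
      exact Ideal.IsPrime.ne_top') rs hrs hreg
  exact isWeaklyRegular_of_subsingleton_ext ys (ModuleCat.of R R)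
    (fun i hi => hext i (hi.trans_le hle)) hmem (fun p hp _ h => hrad p hp h)

/-- A regular sequence in a Noetherian local ring has length at most the dimension. -/
theorem RingTheory.Sequence.IsRegular.length_le_ringKrullDim {R : Type u} [CommRing R]
    [IsNoetherianRing R] [IsLocalRing R] {rs : List R} (h : IsRegular R rs) :
    (rs.length : WithBot ℕ∞) ≤ ringKrullDim R := by
  rw [← ringKrullDim_add_length_eq_ringKrullDim_of_isRegular rs h]
  have : Nontrivial (R ⧸ Ideal.ofList rs) := Ideal.Quotient.nontrivial_iff.2 fun h' => h.2 (by
    rw [h']; simp)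
  exact le_add_of_nonneg_left ringKrullDim_nonneg_of_nontrivial

/-- Depth never exceeds dimension, so a single regular sequence as long as the dimension suffices.
-/
theorem isCohenMacaulayLocalRing_of_isWeaklyRegular {R : Type u} [CommRing R] [IsNoetherianRing R]
    [IsLocalRing R] (rs : List R) (hmem : ∀ r ∈ rs, r ∈ maximalIdeal R)
    (hreg : IsWeaklyRegular R rs) (hdim : ringKrullDim R ≤ rs.length) :
    IsCohenMacaulayLocalRing R := by
  refine ⟨inferInstance, le_antisymm ?_ (hdim.trans ?_)⟩
  · obtain ⟨n, hn⟩ : ∃ n : ℕ∞, ringKrullDim R = n :=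
      ⟨_, (WithBot.coe_unbot (ringKrullDim R) ringKrullDim_ne_bot).symm⟩
    rw [hn]
    refine WithBot.coe_le_coe.2 (iSup₂_le fun qs hqs => ?_)
    have := hqs.2.length_le_ringKrullDim
    rw [hn] at this
    exact_mod_cast this
  · have : (rs.length : ℕ∞) ≤ localRingDepth R :=
      le_iSup₂_of_le (f := fun (rs : List R) (_ : (∀ r ∈ rs, r ∈ IsLocalRing.maximalIdeal R) ∧
        RingTheory.Sequence.IsRegular R rs) => (rs.length : ℕ∞)) rs
        ⟨hmem, .of_isWeaklyRegular_of_mem_maximalIdeal R hmem hreg⟩ le_rfl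
    exact_mod_cast this

/-- A weakly regular sequence on a module is weakly regular on its direct summands. -/
theorem RingTheory.Sequence.IsWeaklyRegular.of_leftInverse {R : Type*} [CommRing R] {M N : Type*}
    [AddCommGroup M] [Module R M] [AddCommGroup N] [Module R N] (i : M →ₗ[R] N) (r : N →ₗ[R] M)
    (hri : r ∘ₗ i = LinearMap.id) {rs : List R} (h : IsWeaklyRegular N rs) :
    IsWeaklyRegular M rs := by
  induction rs generalizing M N with
  | nil => exact .nil R M
  | cons a rs ih =>
    rw [isWeaklyRegular_cons_iff] at h ⊢
    have hinj : Function.Injective i :=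
      Function.LeftInverse.injective (g := r) (fun x => LinearMap.congr_fun hri x)
    refine ⟨fun x y hxy => hinj (h.1 ?_), ih (QuotSMulTop.map a i) (QuotSMulTop.map a r) ?_ h.2⟩
    · simpa using congrArg i hxy
    · rw [← QuotSMulTop.map_comp, hri, QuotSMulTop.map_id]

end

/-! ### Heights, localization of `B ⧸ (f)`, and descent to a direct summand -/

section
open RingTheory.Sequence IsLocalRing Pointwise

theorem Ideal.height_le_height_comap_of_surjective {A B : Type*} [CommRing A] [CommRing B]
    (φ : A →+* B) (hφ : Function.Surjective φ) (Q : Ideal B) [hQ : Q.IsPrime] :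
    Q.height ≤ (Q.comap φ).height := by
  have hmono : StrictMono (PrimeSpectrum.comap φ) := by
    refine Monotone.strictMono_of_injective (fun p q h => ?_)
      (PrimeSpectrum.comap_injective_of_surjective φ hφ)
    exact Ideal.comap_mono h
  have := Order.height_le_height_apply_of_strictMono _ hmono ⟨Q, hQ⟩
  rwa [← PrimeSpectrum.height_eq_orderHeight, ← PrimeSpectrum.height_eq_orderHeight] at this

/-- Extending primes of `A` to `A[X]` and pulling back along `ε` preserves strict chains, since
contraction to `A` recovers the prime. The chain below `Q` gains one more step at the top: the final
prime contains `y`, whereas `X` is not in `Q A[X]`. -/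
theorem Ideal.height_add_one_le_height_comap_of_polynomial {A B : Type*} [CommRing A] [CommRing B]
    [Algebra A B] (ε : B →ₐ[A] Polynomial A) (y : B) (hy : ε y = Polynomial.X)
    (Q : Ideal A) [hQ : Q.IsPrime] :
    Q.height + 1 ≤ (Q.comap ((Polynomial.aeval (0 : A)).comp ε)).height := by
  let ψ : PrimeSpectrum A → PrimeSpectrum B := fun q =>
    have := q.2
    have : (q.1.map Polynomial.C).IsPrime := Ideal.isPrime_map_C_of_isPrime
    PrimeSpectrum.comap ε.toRingHom ⟨q.1.map Polynomial.C, this⟩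
  have hmem (q : PrimeSpectrum A) (a : A) : algebraMap A B a ∈ (ψ q).1 ↔ a ∈ q.1 := by
    change ε (algebraMap A B a) ∈ q.1.map Polynomial.C ↔ _
    rw [AlgHom.commutes, Ideal.mem_map_C_iff]
    refine ⟨fun h => by simpa using h 0, fun h n => ?_⟩
    rw [Polynomial.algebraMap_eq, Polynomial.coeff_C]
    split_ifs <;> simp [h]
  have hmono : StrictMono ψ := by
    refine Monotone.strictMono_of_injective (fun p q h => ?_) (fun p q h => ?_)
    · exact Ideal.comap_mono (Ideal.map_mono h)
    · ext a
      rw [← hmem, ← hmem, h]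
  have h1 := Order.height_le_height_apply_of_strictMono _ hmono ⟨Q, hQ⟩
  rw [← PrimeSpectrum.height_eq_orderHeight, ← PrimeSpectrum.height_eq_orderHeight] at h1
  refine (add_le_add_left h1 1).trans ?_
  have := (ψ ⟨Q, hQ⟩).2
  have : (Q.comap ((Polynomial.aeval (0 : A)).comp ε)).IsPrime := inferInstance
  refine Ideal.height_add_one_le_of_lt_of_isPrime (lt_of_le_of_ne ?_ ?_)
  · intro b hb
    change ε b ∈ Q.map Polynomial.C at hb
    change Polynomial.aeval (0 : A) (ε b) ∈ Q
    rw [Polynomial.coe_aeval_eq_eval, ← Polynomial.coeff_zero_eq_eval_zero]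
    exact Ideal.mem_map_C_iff.1 hb 0
  · intro h
    have hy' : y ∈ Q.comap ((Polynomial.aeval (0 : A)).comp ε) := by
      simp [Ideal.mem_comap, hy]
    rw [← h] at hy'
    change ε y ∈ Q.map Polynomial.C at hy'
    rw [hy] at hy'
    have := Ideal.mem_map_C_iff.1 hy' 1
    rw [Polynomial.coeff_X_one] at this
    exact hQ.ne_top ((Ideal.eq_top_iff_one _).2 this)

/-- If `B` is generated modulo a nilpotent ideal of `B ⧸ (f)` by the base ring `A`, and `P` is a
prime of `B` over `Q`, then `B_P ⧸ (f)` is the localization of the `A`-module `B ⧸ (f)` at `Q`. -/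
theorem isLocalizedModule_quotSMulTop_atPrime {A B : Type*} [CommRing A] [CommRing B] [Algebra A B]
    (f : B) (Q : Ideal A) [Q.IsPrime] (P : Ideal B) [P.IsPrime]
    (hPQ : P.comap (algebraMap A B) = Q)
    (hgen : ∀ b : B, ∃ a : A, b - algebraMap A B a ∈ P ⊓ (Ideal.span {f}).radical) :
    IsLocalizedModule Q.primeCompl
      ((QuotSMulTop.map f
        (IsScalarTower.toAlgHom B B (Localization.AtPrime P)).toLinearMap).restrictScalars A :
        QuotSMulTop f B →ₗ[A] QuotSMulTop f (Localization.AtPrime P)) := by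
  -- Modulo `f`, every `u` outside `P` divides an element of `A` outside `Q`: if `(u - a) ^ k ∈
  -- (f)`, then `u` divides `a ^ k - (a - u) ^ k`. Inverting `A ∖ Q` therefore already inverts `B ∖
  -- P`.
  have key : ∀ u : P.primeCompl, ∃ v : B, ∃ a : Q.primeCompl,
      ∃ t : B, algebraMap A B a = v * u + f * t := by
    intro u
    obtain ⟨a, haP, k, hk⟩ := hgen u
    obtain ⟨t, ht⟩ := Ideal.mem_span_singleton'.1 hk
    have haQ : a ∉ Q := by
      intro ha
      rw [← hPQ] at ha
      exact u.2 (by simpa using P.add_mem haP ha)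
    obtain ⟨v, hv⟩ := sub_dvd_pow_sub_pow (algebraMap A B a) (-(u - algebraMap A B a)) k
    refine ⟨v, ⟨a ^ k, fun h => haQ (Ideal.IsPrime.mem_of_pow_mem ‹_› k h)⟩, (-1) ^ k * t, ?_⟩
    rw [neg_pow, ← ht] at hv
    simp only [map_pow]
    linear_combination hv
  have hunit (a : Q.primeCompl) :
      IsUnit (algebraMap B (Localization.AtPrime P) (algebraMap A B a)) :=
    IsLocalization.map_units (M := P.primeCompl) _ ⟨algebraMap A B a, fun h => a.2 (hPQ ▸ h)⟩
  have hmem (x : Localization.AtPrime P) : x ∈ f • (⊤ : Submodule B (Localization.AtPrime P)) ↔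
      ∃ w, algebraMap B (Localization.AtPrime P) f * w = x := by
    rw [Submodule.mem_smul_pointwise_iff_exists]
    simp [Algebra.smul_def]
  refine ⟨fun a => ?_, fun n => ?_, fun {x₁ x₂} h => ?_⟩
  · rw [Module.End.isUnit_iff]
    obtain ⟨w, hw⟩ := hunit a
    have hsmul (x : Localization.AtPrime P) : (a : A) • x = w * x := by
      rw [hw, ← IsScalarTower.algebraMap_apply A B, Algebra.smul_def]
    constructor
    · rw [← LinearMap.ker_eq_bot, LinearMap.ker_eq_bot']
      intro n hn
      obtain ⟨x, rfl⟩ := Submodule.Quotient.mk_surjective _ n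
      rw [Module.algebraMap_end_apply, ← Submodule.Quotient.mk_smul,
        Submodule.Quotient.mk_eq_zero, hmem] at hn
      obtain ⟨t, ht⟩ := hn
      rw [Submodule.Quotient.mk_eq_zero, hmem]
      refine ⟨↑w⁻¹ * t, ?_⟩
      rw [mul_left_comm, ht, hsmul, Units.inv_mul_cancel_left]
    · intro n
      obtain ⟨x, rfl⟩ := Submodule.Quotient.mk_surjective _ n
      refine ⟨Submodule.Quotient.mk (↑w⁻¹ * x), ?_⟩
      rw [Module.algebraMap_end_apply, ← Submodule.Quotient.mk_smul, hsmul,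
        Units.mul_inv_cancel_left]
  · obtain ⟨x, rfl⟩ := Submodule.Quotient.mk_surjective _ n
    obtain ⟨⟨b, u⟩, hx⟩ := IsLocalization.surj P.primeCompl x
    obtain ⟨v, a, t, h⟩ := key u
    refine ⟨⟨Submodule.Quotient.mk (v * b), a⟩, ?_⟩
    change (a : A) • (Submodule.Quotient.mk x : QuotSMulTop f (Localization.AtPrime P)) =
      Submodule.Quotient.mk (algebraMap B (Localization.AtPrime P) (v * b))
    rw [← Submodule.Quotient.mk_smul, Submodule.Quotient.eq, hmem, Algebra.smul_def,
      IsScalarTower.algebraMap_apply A B, h]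
    refine ⟨algebraMap B _ t * x, ?_⟩
    simp only [map_mul, map_add]
    linear_combination (- algebraMap B (Localization.AtPrime P) v) * hx
  · obtain ⟨x₁, rfl⟩ := Submodule.Quotient.mk_surjective _ x₁
    obtain ⟨x₂, rfl⟩ := Submodule.Quotient.mk_surjective _ x₂
    change (Submodule.Quotient.mk (algebraMap B (Localization.AtPrime P) x₁) :
      QuotSMulTop f (Localization.AtPrime P)) =
      Submodule.Quotient.mk (algebraMap B (Localization.AtPrime P) x₂) at h
    rw [Submodule.Quotient.eq, hmem] at h
    obtain ⟨w, hw⟩ := h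
    obtain ⟨⟨b, u⟩, hx⟩ := IsLocalization.surj P.primeCompl w
    have : algebraMap B (Localization.AtPrime P) (f * b) =
        algebraMap B (Localization.AtPrime P) (u * (x₁ - x₂)) := by
      simp only [map_mul, map_sub]
      linear_combination (algebraMap B (Localization.AtPrime P) u) * hw -
        algebraMap B (Localization.AtPrime P) f * hx
    obtain ⟨c, hc⟩ := (IsLocalization.eq_iff_exists P.primeCompl _).1 this
    obtain ⟨v, a, t, h⟩ := key (c * u)
    refine ⟨a, ?_⟩
    change (a : A) • (Submodule.Quotient.mk x₁ : QuotSMulTop f B) =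
      (a : A) • Submodule.Quotient.mk x₂
    rw [← Submodule.Quotient.mk_smul, ← Submodule.Quotient.mk_smul, Submodule.Quotient.eq,
      Submodule.mem_smul_pointwise_iff_exists]
    refine ⟨v * c * b + t * (x₁ - x₂), trivial, ?_⟩
    change f * (v * c * b + t * (x₁ - x₂)) = (a : A) • x₁ - (a : A) • x₂
    rw [Algebra.smul_def, Algebra.smul_def, h, Submonoid.coe_mul]
    linear_combination v * hc

/-- Let `B` be a Cohen–Macaulay algebra over a Noetherian ring `A`, generated as an `A`-module
modulo the ideal `(y, z)` by `1`, with an `A`-algebra map to `A[X]` sending `y ↦ X` and `z ↦ 0`.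
If `z` is nilpotent in `B ⧸ (f)`, where `f = y - z ^ m`, and a quotient ring `A'` of `A` is an
`A`-module direct summand of `B ⧸ (f)`, then `A'` is Cohen–Macaulay. -/
theorem IsCohenMacaulayRing.of_directSummand {A A' : Type v} {B : Type u} [CommRing A] [CommRing A']
    [CommRing B] [IsNoetherianRing A] [Algebra A B] [Algebra A A']
    (hsurj : Function.Surjective (algebraMap A A')) (y z f : B)
    (hgen : ∀ b : B, ∃ a : A, b - algebraMap A B a ∈ Ideal.span {y, z})
    (ε : B →ₐ[A] Polynomial A) (hεy : ε y = Polynomial.X) (hεz : ε z = 0)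
    (m e : ℕ) (hm : m ≠ 0) (hf : f = y - z ^ m) (hz : f ∣ z ^ e)
    (r : QuotSMulTop f B →ₗ[A] A') (c : QuotSMulTop f B) (hrc : r c = 1)
    (hc : ∀ a : A, algebraMap A A' a = 0 → a • c = 0) (hB : IsCohenMacaulayRing B) :
    IsCohenMacaulayRing A' := by
  have hA' : IsNoetherianRing A' := isNoetherianRing_of_surjective A A' (algebraMap A A') hsurj
  refine ⟨hA', fun Q' _ => ?_⟩
  let η : B →ₐ[A] A := (Polynomial.aeval (0 : A)).comp ε
  have hηy : η y = 0 := by simp [η, hεy]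
  have hηz : η z = 0 := by simp [η, hεz]
  let Q : Ideal A := Q'.comap (algebraMap A A')
  let P : Ideal B := Q.comap η
  have hQ : Q.IsPrime := inferInstance
  have hP : P.IsPrime := inferInstance
  have hyP : y ∈ P := by simp [P, Ideal.mem_comap, hηy]
  have hzP : z ∈ P := by simp [P, Ideal.mem_comap, hηz]
  have hPQ : P.comap (algebraMap A B) = Q := by
    ext a
    simp [P, Ideal.mem_comap]
  have hyz : Ideal.span {y, z} ≤ P ⊓ (Ideal.span {f}).radical := by
    have hzr : z ∈ (Ideal.span {f}).radical := ⟨e, Ideal.mem_span_singleton.2 hz⟩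
    refine Ideal.span_le.2 (Set.insert_subset_iff.2 ⟨⟨hyP, ?_⟩, Set.singleton_subset_iff.2
      ⟨hzP, hzr⟩⟩)
    have : y = f + z ^ m := by rw [hf]; ring
    rw [this]
    exact add_mem (Ideal.le_radical (Ideal.mem_span_singleton_self f))
      (Ideal.pow_mem_of_mem _ hzr m (Nat.pos_of_ne_zero hm))
  obtain ⟨s, hsQ, hscard⟩ := Q.exists_finset_card_eq_height_of_isNoetherianRing
  have hsQ' : ∀ a ∈ s, a ∈ Q := fun a ha => hsQ.1.2 (Ideal.subset_span ha)
  have hdimQ' : Q'.height ≤ Q.height :=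
    Ideal.height_le_height_comap_of_surjective (algebraMap A A') hsurj Q'
  have hdimP : Q.height + 1 ≤ P.height :=
    Ideal.height_add_one_le_height_comap_of_polynomial ε y hεy Q
  have hfP : f ∈ P := hf ▸ sub_mem hyP (Ideal.pow_mem_of_mem _ hzP m (Nat.pos_of_ne_zero hm))
  have hreg : IsWeaklyRegular (Localization.AtPrime P) (f :: s.toList.map (algebraMap A B)) := by
    rw [← isWeaklyRegular_map_algebraMap_iff (Localization.AtPrime P)]
    have hL : ∀ b ∈ f :: s.toList.map (algebraMap A B), b ∈ P := by
      intro b hb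
      rcases List.mem_cons.1 hb with rfl | hb
      · exact hfP
      · obtain ⟨a, ha, rfl⟩ := List.mem_map.1 hb
        exact (hPQ ▸ hsQ' a (Finset.mem_toList.1 ha) : a ∈ P.comap (algebraMap A B))
    refine (hB.localization P).isWeaklyRegular _ ?_ ?_ ?_
    · rw [IsLocalization.AtPrime.ringKrullDim_eq_height P]
      rw [← hscard] at hdimP
      simp only [List.length_map, List.length_cons, Finset.length_toList]
      exact_mod_cast hdimP
    · intro x hx
      obtain ⟨b, hb', rfl⟩ := List.mem_map.1 hx
      exact (IsLocalization.AtPrime.to_map_mem_maximal_iff _ P b).2 (hL b hb')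
    · intro p hp hmem
      have hmem' : ∀ b ∈ f :: s.toList.map (algebraMap A B),
          b ∈ p.comap (algebraMap B (Localization.AtPrime P)) :=
        fun b hb => hmem _ (List.mem_map_of_mem hb)
      set p₁ := p.comap (algebraMap B (Localization.AtPrime P)) with hp₁
      have hp₁' : p₁.IsPrime := inferInstance
      have hp₁P : p₁ ≤ P := fun b hb =>
        (IsLocalization.AtPrime.to_map_mem_maximal_iff (Localization.AtPrime P) P b).1
          (le_maximalIdeal hp.ne_top hb)
      -- The contraction of `p₁` contains `s` and lies in `Q`, so minimality of `Q` over `s`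
      -- applies.
      have hQp : Q ≤ p₁.comap (algebraMap A B) := by
        refine hsQ.2 ⟨inferInstance, Ideal.span_le.2 fun a ha => ?_⟩ ?_
        · exact hmem' _ (List.mem_cons_of_mem _ (List.mem_map_of_mem (Finset.mem_toList.2 ha)))
        · exact (Ideal.comap_mono hp₁P).trans hPQ.le
      have hrad : (Ideal.span {f}).radical ≤ p₁ :=
        hp₁'.radical_le_iff.2 ((Ideal.span_singleton_le_iff_mem _).2 (hmem' f (by simp)))
      have hPp : P ≤ p₁ := by
        intro b hb
        obtain ⟨a, ha⟩ := hgen b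
        have ha' := hyz ha
        have haP : algebraMap A B a ∈ P := by simpa using P.sub_mem hb ha'.1
        have haQ : a ∈ Q := hPQ ▸ haP
        simpa using p₁.add_mem (hrad ha'.2) (hQp haQ)
      rw [← IsLocalization.AtPrime.map_eq_maximalIdeal P (Localization.AtPrime P)]
      exact Ideal.map_le_iff_le_comap.2 hPp
  rw [isWeaklyRegular_cons_iff, isWeaklyRegular_map_algebraMap_iff] at hreg
  have hlocN := isLocalizedModule_quotSMulTop_atPrime f Q P hPQ fun b =>
    (hgen b).imp fun a ha => hyz ha
  have hsub : Algebra.algebraMapSubmonoid A' Q.primeCompl = Q'.primeCompl := by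
    ext x
    obtain ⟨a, rfl⟩ := hsurj x
    refine ⟨?_, fun h => ⟨a, h, rfl⟩⟩
    rintro ⟨b, hb, hba⟩
    rw [← hba]
    exact hb
  have hlocM : IsLocalizedModule Q.primeCompl
      (IsScalarTower.toAlgHom A A' (Localization.AtPrime Q')).toLinearMap := by
    rw [isLocalizedModule_iff_isLocalization, hsub]
    infer_instance
  -- The section `1 ↦ c` of `r`, well defined because `c` is killed by the kernel of `A → A'`.
  let i : A' →ₗ[A] QuotSMulTop f B :=
    ((LinearMap.ker (Algebra.linearMap A A')).liftQ (LinearMap.toSpanSingleton A _ c)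
      (fun a ha => by simpa using hc a (by simpa using ha))) ∘ₗ
    ((Algebra.linearMap A A').quotKerEquivOfSurjective hsurj).symm.toLinearMap
  have hi (a : A) : i (algebraMap A A' a) = a • c := by
    have : ((Algebra.linearMap A A').quotKerEquivOfSurjective hsurj).symm (algebraMap A A' a) =
        Submodule.Quotient.mk a := by
      rw [LinearEquiv.symm_apply_eq]
      rfl
    simp only [i, LinearMap.comp_apply, LinearEquiv.coe_coe, this]
    rfl
  have hri : r ∘ₗ i = LinearMap.id := by
    ext x
    obtain ⟨a, rfl⟩ := hsurj x
    rw [LinearMap.comp_apply, hi, map_smul, hrc, LinearMap.id_apply, Algebra.algebraMap_eq_smul_one]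
  have hreg' : IsWeaklyRegular (Localization.AtPrime Q') s.toList := by
    let gM := (IsScalarTower.toAlgHom A A' (Localization.AtPrime Q')).toLinearMap
    let gN : QuotSMulTop f B →ₗ[A] QuotSMulTop f (Localization.AtPrime P) :=
      (QuotSMulTop.map f
        (IsScalarTower.toAlgHom B B (Localization.AtPrime P)).toLinearMap).restrictScalars A
    have : IsLocalizedModule Q.primeCompl gM := hlocM
    have : IsLocalizedModule Q.primeCompl gN := hlocN
    refine hreg.2.of_leftInverse (IsLocalizedModule.map Q.primeCompl gM gN i)
      (IsLocalizedModule.map Q.primeCompl gN gM r) ?_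
    rw [← IsLocalizedModule.map_comp' Q.primeCompl gM gN gM, hri, IsLocalizedModule.map_id]
  rw [← isWeaklyRegular_map_algebraMap_iff (Localization.AtPrime Q')] at hreg'
  refine isCohenMacaulayLocalRing_of_isWeaklyRegular _ ?_ hreg' ?_
  · intro x hx
    obtain ⟨a, ha, rfl⟩ := List.mem_map.1 hx
    rw [IsScalarTower.algebraMap_apply A A', IsLocalization.AtPrime.to_map_mem_maximal_iff _ Q']
    exact hsQ' a (Finset.mem_toList.1 ha)
  · rw [IsLocalization.AtPrime.ringKrullDim_eq_height Q', List.length_map, Finset.length_toList]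
    exact_mod_cast hdimQ'.trans hscard.ge

end

/-! ### Edge rings and their maps for induced subgraphs -/

namespace WeightedOrientedGraph

variable {V : Type u} (D : WeightedOrientedGraph V) (K : Type v) [Field K]

/-- The quotient of the polynomial ring on the vertices by the edge ideal. -/
def EdgeRing : Type (max u v) := MvPolynomial V K ⧸ D.edgeIdeal K

noncomputable instance : CommRing (D.EdgeRing K) :=
  inferInstanceAs (CommRing (MvPolynomial V K ⧸ D.edgeIdeal K))

noncomputable instance : Algebra K (D.EdgeRing K) :=
  inferInstanceAs (Algebra K (MvPolynomial V K ⧸ D.edgeIdeal K))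

instance [Finite V] : IsNoetherianRing (D.EdgeRing K) :=
  inferInstanceAs (IsNoetherianRing (MvPolynomial V K ⧸ D.edgeIdeal K))

theorem isCohenMacaulay_iff : D.IsCohenMacaulay K ↔ IsCohenMacaulayRing (D.EdgeRing K) := Iff.rfl

/-- The projection from the polynomial ring onto the edge ring. -/
noncomputable def edgeRingMk : MvPolynomial V K →ₐ[K] D.EdgeRing K :=
  Ideal.Quotient.mkₐ K (D.edgeIdeal K)

/-- The class of the variable of a vertex in the edge ring. -/
noncomputable def edgeRingX (a : V) : D.EdgeRing K :=
  D.edgeRingMk K (MvPolynomial.X a)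

variable {D} in
theorem edgeRingX_mul_pow {a b : V} (h : D.Adj a b) :
    D.edgeRingX K a * D.edgeRingX K b ^ D.weight b = 0 := by
  rw [edgeRingX, edgeRingX, ← map_pow, ← map_mul]
  exact Ideal.Quotient.eq_zero_iff_mem.2 (Ideal.subset_span ⟨a, b, h, rfl⟩)

variable {K} {R : Type*} [CommRing R] [Algebra K R]

/-- The algebra map out of the edge ring determined by the images of the vertices. -/
noncomputable def edgeRingLift (g : V → R)
    (hg : ∀ a b, D.Adj a b → g a * g b ^ D.weight b = 0) : D.EdgeRing K →ₐ[K] R :=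
  Ideal.Quotient.liftₐ (D.edgeIdeal K) (MvPolynomial.aeval g) fun p hp => by
    have : D.edgeIdeal K ≤ RingHom.ker (MvPolynomial.aeval (R := K) g) := by
      refine Ideal.span_le.2 ?_
      rintro _ ⟨a, b, hab, rfl⟩
      simpa using hg a b hab
    exact this hp

@[simp]
theorem edgeRingLift_X (g : V → R) (hg : ∀ a b, D.Adj a b → g a * g b ^ D.weight b = 0) (a : V) :
    D.edgeRingLift (K := K) g hg (D.edgeRingX K a) = g a := by
  have : D.edgeRingLift (K := K) g hg (D.edgeRingX K a) =
    MvPolynomial.aeval (R := K) g (MvPolynomial.X a) := rfl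
  rw [this, MvPolynomial.aeval_X]

variable {D} in
theorem edgeRing_algHom_ext {φ ψ : D.EdgeRing K →ₐ[K] R}
    (h : ∀ a, φ (D.edgeRingX K a) = ψ (D.edgeRingX K a)) : φ = ψ := by
  refine Ideal.Quotient.algHom_ext K ?_
  refine MvPolynomial.algHom_ext fun a => h a

variable (K) (S : Set V)

/-- The map of edge rings given by the inclusion of an induced subgraph. -/
noncomputable def edgeRingIncl : (D.deleteVertices S).EdgeRing K →ₐ[K] D.EdgeRing K :=
  edgeRingLift _ (fun a => D.edgeRingX K a) fun _ _ h => D.edgeRingX_mul_pow K h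

@[simp]
theorem edgeRingIncl_X (a : {a : V // a ∉ S}) :
    D.edgeRingIncl K S ((D.deleteVertices S).edgeRingX K a) = D.edgeRingX K a :=
  edgeRingLift_X _ _ _ a

open Classical in
/-- The map from the edge ring to the edge ring of an induced subgraph that sends the deleted
vertices to `0`. -/
noncomputable def edgeRingRestrict : D.EdgeRing K →ₐ[K] (D.deleteVertices S).EdgeRing K :=
  edgeRingLift _ (fun a => if h : a ∉ S then (D.deleteVertices S).edgeRingX K ⟨a, h⟩ else 0) <| by
    intro a b hab
    by_cases ha : a ∈ S
    · simp [ha]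
    by_cases hb : b ∈ S
    · simp [hb, (D.weight_pos b).ne']
    · rw [dif_pos ha, dif_pos hb]
      exact (D.deleteVertices S).edgeRingX_mul_pow K (a := ⟨a, ha⟩) (b := ⟨b, hb⟩) hab

theorem edgeRingRestrict_X_of_notMem {a : V} (h : a ∉ S) :
    D.edgeRingRestrict K S (D.edgeRingX K a) = (D.deleteVertices S).edgeRingX K ⟨a, h⟩ := by
  simp [edgeRingRestrict, h]

theorem edgeRingRestrict_X_of_mem {a : V} (h : a ∈ S) :
    D.edgeRingRestrict K S (D.edgeRingX K a) = 0 := by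
  simp [edgeRingRestrict, h]

theorem edgeRingRestrict_edgeRingIncl (x : (D.deleteVertices S).EdgeRing K) :
    D.edgeRingRestrict K S (D.edgeRingIncl K S x) = x := by
  have : (D.edgeRingRestrict K S).comp (D.edgeRingIncl K S) = AlgHom.id K _ :=
    edgeRing_algHom_ext fun a => by
      simp [edgeRingRestrict_X_of_notMem D K S a.2]
  exact DFunLike.congr_fun this x

/-- Modulo the deleted variables, the identity and restriction followed by inclusion agree on every
variable. This gives generation by `1` modulo `(y, z)`, and also bounds the kernel of restriction.
-/
theorem edgeRing_sub_incl_restrict_mem (x : D.EdgeRing K) :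
    x - D.edgeRingIncl K S (D.edgeRingRestrict K S x) ∈ Ideal.span (D.edgeRingX K '' S) := by
  have : (Ideal.Quotient.mkₐ K (Ideal.span (D.edgeRingX K '' S))).comp
      ((D.edgeRingIncl K S).comp (D.edgeRingRestrict K S)) =
        Ideal.Quotient.mkₐ K (Ideal.span (D.edgeRingX K '' S)) := by
    refine edgeRing_algHom_ext (D := D) (K := K)
      (R := D.EdgeRing K ⧸ Ideal.span (D.edgeRingX K '' S)) fun a => ?_
    by_cases h : a ∈ S
    · rw [AlgHom.comp_apply, AlgHom.comp_apply, edgeRingRestrict_X_of_mem D K S h, map_zero,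
        map_zero]
      exact (Ideal.Quotient.eq_zero_iff_mem.2 (Ideal.subset_span (Set.mem_image_of_mem _ h))).symm
    · rw [AlgHom.comp_apply, AlgHom.comp_apply, edgeRingRestrict_X_of_notMem D K S h,
        edgeRingIncl_X]
  rw [← Ideal.Quotient.eq]
  exact (DFunLike.congr_fun this x).symm

end WeightedOrientedGraph

/-! ### Linear forms on quotients, used for the retractions -/

namespace Polynomial

/-- The `m`-th coefficient, as a linear form on `R[X] ⧸ (X ^ (m + 1))`. -/
noncomputable def truncCoeff (R : Type*) [CommRing R] (m : ℕ) :
    (Polynomial R ⧸ Ideal.span {(X : Polynomial R) ^ (m + 1)}) →ₗ[R] R :=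
  ((Ideal.span {(X : Polynomial R) ^ (m + 1)}).restrictScalars R).liftQ (lcoeff R m) (by
    intro p hp
    rw [Submodule.restrictScalars_mem, Ideal.mem_span_singleton] at hp
    exact X_pow_dvd_iff.1 hp m (Nat.lt_succ_self m)) ∘ₗ
  (Submodule.Quotient.restrictScalarsEquiv R (Ideal.span {(X : Polynomial R) ^ (m + 1)})).symm

theorem truncCoeff_mk {R : Type*} [CommRing R] (m : ℕ) (p : Polynomial R) :
    truncCoeff R m (Ideal.Quotient.mk _ p) = p.coeff m := rfl

end Polynomial

open scoped Pointwise in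
/-- An `A`-linear map from `B` that vanishes on the multiples of `f` descends to
`B ⧸ f B`. -/
noncomputable def QuotSMulTop.liftBase {A B M : Type*} [CommRing A] [CommRing B] [Algebra A B]
    [AddCommGroup M] [Module A M] (f : B) (r : B →ₗ[A] M) (hr : ∀ b, r (f * b) = 0) :
    QuotSMulTop f B →ₗ[A] M :=
  ((f • (⊤ : Submodule B B)).restrictScalars A).liftQ r (by
    intro x hx
    obtain ⟨b, -, rfl⟩ := (Submodule.mem_smul_pointwise_iff_exists _ _ _).1 hx
    exact hr b) ∘ₗ
  (Submodule.Quotient.restrictScalarsEquiv A (f • (⊤ : Submodule B B))).symm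

/-! ### Removing a whisker -/

namespace WeightedOrientedGraph

variable {V : Type u} (D : WeightedOrientedGraph V)

theorem underlying_adj_iff {a b : V} : D.underlying.Adj a b ↔ D.Adj a b ∨ D.Adj b a := by
  refine ⟨fun h => h.2, fun h => ⟨?_, h⟩⟩
  rintro rfl
  exact h.elim (fun h => D.asymm _ _ h h) (fun h => D.asymm _ _ h h)

/-- `y` is a leaf at `z`, and all other edges at `z` are directed from `X` into `z`. -/
structure IsWhisker (z y : V) (X : Set V) : Prop where
  ne : z ≠ y
  notMem : ∀ x ∈ X, x ∉ ({z, y} : Set V)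
  adj_or : D.Adj z y ∨ D.Adj y z
  adj_of_mem : ∀ x ∈ X, D.Adj x z
  edge_cases : ∀ a b, D.Adj a b → (a ∉ ({z, y} : Set V) ∧ b ∉ ({z, y} : Set V)) ∨ (a ∈ X ∧ b = z) ∨
    (a = y ∧ b = z) ∨ (a = z ∧ b = y)

namespace IsWhisker

variable {D} {z y : V} {X : Set V} (K : Type v) [Field K]
open Classical in
theorem exists_algHom_extending {R : Type*} [CommRing R] [Algebra K R] (h : D.IsWhisker z y X)
    (ρ : (D.deleteVertices {z, y}).EdgeRing K →ₐ[K] R) (s t : R)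
    (hX : ∀ x (hx : x ∈ X), ρ ((D.deleteVertices {z, y}).edgeRingX K ⟨x, h.notMem x hx⟩) *
      s ^ D.weight z = 0)
    (hts : t * s ^ D.weight z = 0) (hst : s * t ^ D.weight y = 0) :
    ∃ ε : D.EdgeRing K →ₐ[K] R, (∀ x, ε (D.edgeRingIncl K {z, y} x) = ρ x) ∧
      ε (D.edgeRingX K y) = t ∧ ε (D.edgeRingX K z) = s := by
  let g : V → R := fun a => if ha : a ∉ ({z, y} : Set V) then
    ρ ((D.deleteVertices {z, y}).edgeRingX K ⟨a, ha⟩) else if a = y then t else s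
  have hg {a : V} (ha : a ∉ ({z, y} : Set V)) :
      g a = ρ ((D.deleteVertices {z, y}).edgeRingX K ⟨a, ha⟩) := dif_pos ha
  have hgy : g y = t := by simp [g]
  have hgz : g z = s := by simp [g, h.ne]
  have hzero : ∀ a b, D.Adj a b → g a * g b ^ D.weight b = 0 := by
    intro a b hab
    rcases h.edge_cases a b hab with ⟨ha, hb⟩ | ⟨ha, rfl⟩ | ⟨rfl, rfl⟩ | ⟨rfl, rfl⟩
    · rw [hg ha, hg hb, ← map_pow, ← map_mul]
      exact (congrArg ρ ((D.deleteVertices {z, y}).edgeRingX_mul_pow K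
        (a := ⟨a, ha⟩) (b := ⟨b, hb⟩) hab)).trans (map_zero ρ)
    · rw [hg (h.notMem a ha), hgz, hX a ha]
    · rw [hgy, hgz, hts]
    · rw [hgy, hgz, hst]
  refine ⟨D.edgeRingLift g hzero, fun x => ?_, ?_, ?_⟩
  · refine DFunLike.congr_fun (f := (D.edgeRingLift g hzero).comp (D.edgeRingIncl K {z, y}))
      (g := ρ) (edgeRing_algHom_ext fun a => ?_) x
    rw [AlgHom.comp_apply, edgeRingIncl_X, edgeRingLift_X, hg a.2]
  · rw [edgeRingLift_X, hgy]
  · rw [edgeRingLift_X, hgz]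

theorem exists_algHom_polynomial (h : D.IsWhisker z y X) :
    ∃ ε : D.EdgeRing K →ₐ[K] Polynomial ((D.deleteVertices {z, y}).EdgeRing K),
      (∀ x, ε (D.edgeRingIncl K {z, y} x) = Polynomial.C x) ∧
      ε (D.edgeRingX K y) = Polynomial.X ∧ ε (D.edgeRingX K z) = 0 :=
  h.exists_algHom_extending K Polynomial.CAlgHom 0 Polynomial.X
    (by simp [(D.weight_pos z).ne']) (by simp [(D.weight_pos z).ne']) (by simp)

/-- This map kills `y - z ^ w(z)`, and the top coefficient of the image of `z ^ w(z)` is `1`, which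
splits off the edge ring of `D_F`. -/
theorem exists_algHom_trunc (h : D.IsWhisker z y X) :
    ∃ σ : D.EdgeRing K →ₐ[K] (Polynomial (((D.deleteVertices {z, y}).deleteVertices
        (Subtype.val ⁻¹' X)).EdgeRing K) ⧸ Ideal.span {(Polynomial.X : Polynomial
        (((D.deleteVertices {z, y}).deleteVertices (Subtype.val ⁻¹' X)).EdgeRing K)) ^
          (D.weight z + 1)}),
      (∀ x, σ (D.edgeRingIncl K {z, y} x) = Ideal.Quotient.mk _ (Polynomial.C
        ((D.deleteVertices {z, y}).edgeRingRestrict K (Subtype.val ⁻¹' X) x))) ∧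
      σ (D.edgeRingX K y) = Ideal.Quotient.mk _ (Polynomial.X ^ D.weight z) ∧
      σ (D.edgeRingX K z) = Ideal.Quotient.mk _ Polynomial.X := by
  set G := D.deleteVertices {z, y}
  set S : Set {a // a ∉ ({z, y} : Set V)} := Subtype.val ⁻¹' X
  set I := Ideal.span {(Polynomial.X : Polynomial ((G.deleteVertices S).EdgeRing K)) ^
    (D.weight z + 1)}
  have hzero {n : ℕ} (hn : D.weight z + 1 ≤ n) : Ideal.Quotient.mk I (Polynomial.X ^ n) = 0 :=
    Ideal.Quotient.eq_zero_iff_mem.2 (Ideal.mem_span_singleton.2 (pow_dvd_pow _ hn))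
  have hwz := D.weight_pos z
  have hwy := D.weight_pos y
  refine h.exists_algHom_extending K
    ((Ideal.Quotient.mkₐ K I).comp (Polynomial.CAlgHom.comp (G.edgeRingRestrict K S)))
    (Ideal.Quotient.mk I Polynomial.X) (Ideal.Quotient.mk I (Polynomial.X ^ D.weight z)) ?_ ?_ ?_
  · intro x hx
    rw [AlgHom.comp_apply, AlgHom.comp_apply,
      G.edgeRingRestrict_X_of_mem K S (a := ⟨x, h.notMem x hx⟩) hx, map_zero, map_zero, zero_mul]
  · rw [← map_pow, ← map_mul, ← pow_add, hzero (by omega)]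
  -- The exponent is `w(z) w(y) + 1`, at least `w(z) + 1` because `w(y) ≥ 1`.
  · rw [← map_pow, ← map_mul, ← pow_mul, ← pow_succ', hzero (by nlinarith)]

/-- The kernel of restriction is generated by the `x_i`, and each edge `(x_i, z)` gives `x_i z ^
w(z) = 0`. -/
theorem incl_mul_pow_eq_zero (h : D.IsWhisker z y X) (x : (D.deleteVertices {z, y}).EdgeRing K)
    (hx : (D.deleteVertices {z, y}).edgeRingRestrict K (Subtype.val ⁻¹' X) x = 0) :
    D.edgeRingIncl K {z, y} x * D.edgeRingX K z ^ D.weight z = 0 := by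
  have hmem := (D.deleteVertices {z, y}).edgeRing_sub_incl_restrict_mem K (Subtype.val ⁻¹' X) x
  rw [hx, map_zero, sub_zero] at hmem
  clear hx
  induction hmem using Submodule.span_induction with
  | mem x hx =>
    obtain ⟨a, ha, rfl⟩ := hx
    rw [edgeRingIncl_X]
    exact D.edgeRingX_mul_pow K (h.adj_of_mem _ ha)
  | zero => simp
  | add a b _ _ ha hb => rw [map_add, add_mul, ha, hb, add_zero]
  | smul a b _ hb => rw [smul_eq_mul, map_mul, mul_assoc, hb, mul_zero]

/-- Substituting `y = z ^ w(z)` in the relation of the edge between `y` and `z` leaves a pure power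
of `z`, whichever way the edge points. -/
theorem sub_dvd_pow (h : D.IsWhisker z y X) :
    ∃ e, D.edgeRingX K y - D.edgeRingX K z ^ D.weight z ∣ D.edgeRingX K z ^ e := by
  set a := D.edgeRingX K y
  set b := D.edgeRingX K z
  set m := D.weight z
  rcases h.adj_or with hzy | hyz
  · have h1 : b * a ^ D.weight y = 0 := D.edgeRingX_mul_pow K hzy
    obtain ⟨t, ht⟩ := sub_dvd_pow_sub_pow a (b ^ m) (D.weight y)
    refine ⟨m * D.weight y + 1, - b * t, ?_⟩
    rw [pow_succ, pow_mul]
    linear_combination h1 - b * ht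
  · have h1 : a * b ^ m = 0 := D.edgeRingX_mul_pow K hyz
    refine ⟨m + m, - b ^ m, ?_⟩
    rw [pow_add]
    linear_combination h1

theorem isCohenMacaulay [Finite V] (h : D.IsWhisker z y X) (hD : D.IsCohenMacaulay K) :
    (D.deleteVertices {z, y}).IsCohenMacaulay K ∧
      ((D.deleteVertices {z, y}).deleteVertices (Subtype.val ⁻¹' X)).IsCohenMacaulay K := by
  obtain ⟨ε, hε, hεy, hεz⟩ := h.exists_algHom_polynomial K
  obtain ⟨σ, hσ, hσy, hσz⟩ := h.exists_algHom_trunc K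
  obtain ⟨e, he⟩ := h.sub_dvd_pow K
  set f := D.edgeRingX K y - D.edgeRingX K z ^ D.weight z with hf
  let _ : Algebra ((D.deleteVertices {z, y}).EdgeRing K) (D.EdgeRing K) :=
    (D.edgeRingIncl K {z, y}).toRingHom.toAlgebra
  have hsmul (a : (D.deleteVertices {z, y}).EdgeRing K) (b : D.EdgeRing K) :
      a • b = D.edgeRingIncl K {z, y} a * b := rfl
  let ε' : D.EdgeRing K →ₐ[(D.deleteVertices {z, y}).EdgeRing K]
      Polynomial ((D.deleteVertices {z, y}).EdgeRing K) :=
    { ε.toRingHom with commutes' := hε }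
  have hgen : ∀ b : D.EdgeRing K, ∃ a : (D.deleteVertices {z, y}).EdgeRing K,
      b - algebraMap _ (D.EdgeRing K) a ∈
      Ideal.span {D.edgeRingX K y, D.edgeRingX K z} := by
    intro b
    refine ⟨D.edgeRingRestrict K {z, y} b, ?_⟩
    rw [Set.pair_comm, ← Set.image_pair]
    exact D.edgeRing_sub_incl_restrict_mem K {z, y} b
  have hm := (D.weight_pos z).ne'
  rw [isCohenMacaulay_iff] at hD
  constructor
  · let r : D.EdgeRing K →ₗ[(D.deleteVertices {z, y}).EdgeRing K]
        (D.deleteVertices {z, y}).EdgeRing K :=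
      { toFun := D.edgeRingRestrict K {z, y}
        map_add' := map_add _
        map_smul' a b := by
          rw [hsmul, map_mul, D.edgeRingRestrict_edgeRingIncl, RingHom.id_apply, smul_eq_mul] }
    refine IsCohenMacaulayRing.of_directSummand (A := (D.deleteVertices {z, y}).EdgeRing K)
      (A' := (D.deleteVertices {z, y}).EdgeRing K)
      Function.surjective_id (D.edgeRingX K y) (D.edgeRingX K z) f hgen ε' hεy hεz (D.weight z) e hm
      hf he (QuotSMulTop.liftBase f r fun b => ?_) (Submodule.Quotient.mk 1) ?_ ?_ hD
    · change D.edgeRingRestrict K {z, y} (f * b) = 0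
      rw [map_mul, hf, map_sub, map_pow, D.edgeRingRestrict_X_of_mem K {z, y} (by simp),
        D.edgeRingRestrict_X_of_mem K {z, y} (by simp), zero_pow hm, sub_zero, zero_mul]
    · exact map_one (D.edgeRingRestrict K {z, y})
    · intro a ha
      rw [show a = 0 from ha, zero_smul]
  · let _ : Algebra ((D.deleteVertices {z, y}).EdgeRing K)
        (((D.deleteVertices {z, y}).deleteVertices (Subtype.val ⁻¹' X)).EdgeRing K) :=
      ((D.deleteVertices {z, y}).edgeRingRestrict K (Subtype.val ⁻¹' X)).toRingHom.toAlgebra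
    let r : D.EdgeRing K →ₗ[(D.deleteVertices {z, y}).EdgeRing K]
        ((D.deleteVertices {z, y}).deleteVertices (Subtype.val ⁻¹' X)).EdgeRing K :=
      { toFun b := Polynomial.truncCoeff _ (D.weight z) (σ b)
        map_add' _ _ := by rw [map_add, map_add]
        map_smul' a b := by
          obtain ⟨p, hp⟩ := Ideal.Quotient.mk_surjective (σ b)
          rw [hsmul, map_mul, hσ, ← hp, ← map_mul, Polynomial.truncCoeff_mk,
            Polynomial.truncCoeff_mk, Polynomial.coeff_C_mul]
          rfl }
    refine IsCohenMacaulayRing.of_directSummand (A := (D.deleteVertices {z, y}).EdgeRing K)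
      (A' := ((D.deleteVertices {z, y}).deleteVertices (Subtype.val ⁻¹' X)).EdgeRing K)
      (fun x => ⟨_, (D.deleteVertices {z, y}).edgeRingRestrict_edgeRingIncl K (Subtype.val ⁻¹' X) x⟩)
      (D.edgeRingX K y) (D.edgeRingX K z) f hgen ε' hεy hεz (D.weight z) e hm
      hf he (QuotSMulTop.liftBase f r fun b => ?_)
      (Submodule.Quotient.mk (D.edgeRingX K z ^ D.weight z)) ?_ ?_ hD
    · change Polynomial.truncCoeff _ (D.weight z) (σ (f * b)) = 0
      rw [map_mul, hf, map_sub, map_pow, hσy, hσz, map_pow, sub_self, zero_mul, map_zero]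
    · change Polynomial.truncCoeff _ (D.weight z) (σ (D.edgeRingX K z ^ D.weight z)) = 1
      rw [map_pow, hσz, ← map_pow, Polynomial.truncCoeff_mk, Polynomial.coeff_X_pow_self]
    · intro a ha
      rw [← Submodule.Quotient.mk_smul, hsmul, h.incl_mul_pow_eq_zero K a ha,
        Submodule.Quotient.mk_zero]

end IsWhisker

end WeightedOrientedGraph

theorem proposition3p1 {V : Type u} [Finite V] (K : Type v) [Field K]
    (DH : WeightedOrientedGraph V) (z y : V)
    -- `z` is adjacent to `y`, `deg z ≥ 2` and `deg y = 1`
    (hzy : DH.underlying.Adj z y)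
    (hdegz : 2 ≤ (DH.underlying.neighborSet z).ncard)
    (hdegy : (DH.underlying.neighborSet y).ncard = 1)
    -- `X = {x_1, …, x_k}` consists of the neighbours of `z` other than `y`
    (X : Set V) (hX : X = DH.underlying.neighborSet z \ {y})
    -- every `(x_i, z)` is an edge directed into `z`
    (hXz : ∀ x ∈ X, DH.Adj x z)
    (hCM : DH.IsCohenMacaulay K) :
    (DH.deleteVertices {z, y}).IsCohenMacaulay K ∧
      ((DH.deleteVertices {z, y}).deleteVertices (Subtype.val ⁻¹' X)).IsCohenMacaulay K := by
  subst hX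
  have hz : DH.underlying.neighborSet y = {z} := by
    obtain ⟨a, ha⟩ := Set.ncard_eq_one.1 hdegy
    have : z ∈ DH.underlying.neighborSet y := hzy.symm
    rw [ha] at this ⊢
    rw [Set.mem_singleton_iff.1 this]
  have hy (a : V) (ha : DH.underlying.Adj y a) : a = z := by
    have : a ∈ DH.underlying.neighborSet y := ha
    rwa [hz] at this
  refine WeightedOrientedGraph.IsWhisker.isCohenMacaulay K ⟨hzy.ne, ?_,
    DH.underlying_adj_iff.1 hzy, hXz, ?_⟩ hCM
  · rintro x ⟨hxz, hxy⟩ (rfl | hx)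
    · exact DH.underlying.irrefl hxz
    · exact hxy hx
  · intro a b hab
    have hadj : DH.underlying.Adj a b := DH.underlying_adj_iff.2 (Or.inl hab)
    simp only [Set.mem_insert_iff, Set.mem_singleton_iff, not_or]
    rcases eq_or_ne a y with rfl | hay
    · exact Or.inr (Or.inr (Or.inl ⟨rfl, hy b hadj⟩))
    rcases eq_or_ne b y with rfl | hby
    · exact Or.inr (Or.inr (Or.inr ⟨hy a hadj.symm, rfl⟩))
    rcases eq_or_ne a z with rfl | haz
    -- An edge leaving `z` towards `b ≠ y` would be opposite to the edge `(b, z)`.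
    · exact absurd (hXz b ⟨hadj, hby⟩) (DH.asymm _ _ hab)
    rcases eq_or_ne b z with rfl | hbz
    · exact Or.inr (Or.inl ⟨⟨hadj.symm, hay⟩, rfl⟩)
    · exact Or.inl ⟨⟨haz, hay⟩, hbz, hby⟩
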